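/- Let $\Omega\subset\mathbb R^n$ ($n=2$ or $n=3$) be a bounded Lipschitz domain, and let $$Ay=-\sum_{i,j=1}^n\partial_{x_i}\big(a_{ij}\,\partial_{x_j}y\big)+c_0\,y ,$$ where $a_{ij}=a_{ji}\in C^{0,1}(\overline\Omega)$, $c_0\in L^\infty(\Omega)$, and there is $\sigma>0$ with $\sum_{i,j}a_{ij}(x)\xi_i\xi_j\ge\sigma|\xi|^2$ for all $\xi\in\mathbb R^n$ and almost all $x\in\Omega$. Let $A^*$ be the adjoint of $A$; boundary value problems with homogeneous Dirichlet conditions are understood in the weak sense in $H_0^1(\Omega)$, through the bilinear form $a(y,v)=\int_\Omega \sum_{i,j}a_{ij}\,\partial_{x_j}y\,\partial_{x_i}v+c_0\,y\,v\,dx$. Let $f,y_d\in L^2(\Omega)$, $\alpha>0$, $\beta>0$, $p>1$, $\gamma>0$, and put $$h_{p,\gamma}(v)=\begin{cases}\frac{\gamma^{p-1}}{p}|v|^p,&|v|\le\frac1\gamma,\\ |v|+\frac1\gamma\frac{1-p}{p},&|v|>\frac1\gamma,\end{cases}\qquad \Upsilon_{p,\gamma}(u)=\int_\Omega h_{p,\gamma}(u(x))^{1/p}\,dx,\qquad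 \delta_\gamma=\frac{\gamma^{(p-1)/p}}{p^{1/p}} .$$ Let $(\bar y,\bar u)\in H_0^1(\Omega)\times L^2(\Omega)$ be a (global) solution of the problem $$(P_\gamma)\qquad \min_{(y,u)\in H_0^1(\Omega)\times L^2(\Omega)}\ \tfrac12\|y-y_d\|_{L^2(\Omega)}^2+\tfrac\alpha2\|u\|_{L^2(\Omega)}^2+\beta\,\Upsilon_{p,\gamma}(u)\quad\text{subject to}\quad Ay=u+f\ \text{in }\Omega,\quad y=0\ \text{on }\partial\Omega .$$ Let $\bar w$ be defined by $$\bar w(x)=\begin{cases}\Big[\delta_\gamma-\frac1p\Big(|\bar u(x)|+\frac1\gamma\frac{1-p}{p}\Big)^{\frac{1-p}{p}}\Big]\operatorname{sign}(\bar u(x)),&|\bar u(x)|>\frac1\gamma,\\ 0,&\text{otherwise.}\end{cases}$$ Then $\bar w\in L^2(\Omega)$, and there exist $\bar\phi\in H_0^1(\Omega)$ and $\zeta\in L^2(\Omega)$ such that $$A\bar y=\bar u+f\ \text{in }\Omega,\qquad \bar y=0\ \text{on }\partial\Omega,$$ $$A^*\bar\phi=\bar y-y_d\ \text{in }\Omega,\qquad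 \bar\phi=0\ \text{on }\partial\Omega,$$ $$\bar\phi+\alpha\bar u+\beta(\delta_\gamma\zeta-\bar w)=0,$$ and, for almost all $x\in\Omega$: $\zeta(x)=1$ if $\bar u(x)>0$, $\zeta(x)=-1$ if $\bar u(x)<0$, and $|\zeta(x)|\le1$ if $\bar u(x)=0$. -/

import Mathlib

open MeasureTheory Set Filter Topology
open scoped ContDiff NNReal ENNReal

noncomputable section

namespace SparseControl

/-- `ℝⁿ` with the Euclidean norm. -/
abbrev E (n : ℕ) : Type := EuclideanSpace ℝ (Fin n)

/-- `Ω` has a Lipschitz boundary: near each boundary point there are a unit direction `ν` and a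
Lipschitz function `g` of the component orthogonal to `ν` such that, locally, `Ω` is the set of
points lying strictly above the graph of `g` in the direction `ν`. -/
def HasLipschitzBoundary {n : ℕ} (Ω : Set (E n)) : Prop :=
  ∀ x ∈ frontier Ω, ∃ r > (0 : ℝ), ∃ ν : E n, ‖ν‖ = 1 ∧ ∃ K : ℝ≥0, ∃ g : E n → ℝ,
    LipschitzWith K g ∧
      ∀ z ∈ Metric.ball x r, z ∈ Ω ↔ g (z - inner ℝ z ν • ν) < inner ℝ z ν

/-- A bounded Lipschitz domain: nonempty, open, connected, bounded, with Lipschitz boundary. -/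
structure IsBoundedLipschitzDomain {n : ℕ} (Ω : Set (E n)) : Prop where
  isOpen : IsOpen Ω
  isConnected : IsConnected Ω
  isBounded : Bornology.IsBounded Ω
  lipschitzBoundary : HasLipschitzBoundary Ω

/-- `L²(Ω)`. -/
abbrev L2 {n : ℕ} (Ω : Set (E n)) : Type := Lp ℝ 2 (volume.restrict Ω)

/-- `L²(Ω; ℝⁿ)`. -/
abbrev L2Vec {n : ℕ} (Ω : Set (E n)) : Type := Lp (E n) 2 (volume.restrict Ω)

/-- `L²(Ω) × L²(Ω; ℝⁿ)` with the norm `(‖y‖² + ‖g‖²)^{1/2}`, which on pairs `(y, ∇y)` is the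
`H¹(Ω)` norm. -/
abbrev L2Pair {n : ℕ} (Ω : Set (E n)) : Type := WithLp 2 (L2 Ω × L2Vec Ω)

/-- Test functions `C_c^∞(Ω)`. -/
structure IsTestFunction {n : ℕ} (Ω : Set (E n)) (φ : E n → ℝ) : Prop where
  smooth : ContDiff ℝ ∞ φ
  compactSupport : HasCompactSupport φ
  support_subset : tsupport φ ⊆ Ω

/-- The `i`-th partial derivative. -/
def partialDeriv {n : ℕ} (i : Fin n) (φ : E n → ℝ) (x : E n) : ℝ :=
  fderiv ℝ φ x (EuclideanSpace.single i 1)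

/-- The pairs `(φ, ∇φ)` with `φ` a test function, as a subspace of `L²(Ω) × L²(Ω; ℝⁿ)`. -/
def testPairs {n : ℕ} (Ω : Set (E n)) : Submodule ℝ (L2Pair Ω) where
  carrier := {v | ∃ φ : E n → ℝ, IsTestFunction Ω φ ∧
    (∀ᵐ x ∂(volume.restrict Ω), v.fst x = φ x) ∧
    ∀ᵐ x ∂(volume.restrict Ω), ∀ i : Fin n, v.snd x i = partialDeriv i φ x}
  zero_mem' := by
    refine ⟨0, ⟨contDiff_const, HasCompactSupport.zero, by simp [tsupport]⟩, ?_, ?_⟩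
    · filter_upwards [Lp.coeFn_zero ℝ 2 (volume.restrict Ω)] with x hx using hx
    · filter_upwards [Lp.coeFn_zero (E n) 2 (volume.restrict Ω)] with x hx i
      have h : (0 : L2Pair Ω).snd = 0 := rfl
      rw [h, hx]
      simp [partialDeriv]
  add_mem' := by
    rintro v w ⟨φ, hφ, h1, h2⟩ ⟨ψ, hψ, k1, k2⟩
    refine ⟨φ + ψ, ⟨hφ.smooth.add hψ.smooth, hφ.compactSupport.add hψ.compactSupport,
      (tsupport_add φ ψ).trans (union_subset hφ.support_subset hψ.support_subset)⟩, ?_, ?_⟩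
    · filter_upwards [h1, k1, Lp.coeFn_add v.fst w.fst] with x a b c
      have h : (v + w).fst = v.fst + w.fst := rfl
      rw [h, c, Pi.add_apply, Pi.add_apply, a, b]
    · filter_upwards [h2, k2, Lp.coeFn_add v.snd w.snd] with x a b c i
      have h : (v + w).snd = v.snd + w.snd := rfl
      rw [h, c, Pi.add_apply, PiLp.add_apply, a i, b i, partialDeriv, partialDeriv, partialDeriv,
        fderiv_add ((hφ.smooth.differentiable (by simp)) x)
          ((hψ.smooth.differentiable (by simp)) x)]
      rfl
  smul_mem' := by
    rintro t v ⟨φ, hφ, h1, h2⟩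
    refine ⟨t • φ, ⟨contDiff_const.smul hφ.smooth, hφ.compactSupport.smul_left,
      (tsupport_smul_subset_right (fun _ => t) φ).trans hφ.support_subset⟩, ?_, ?_⟩
    · filter_upwards [h1, Lp.coeFn_smul t v.fst] with x a c
      have h : (t • v).fst = t • v.fst := rfl
      rw [h, c, Pi.smul_apply, Pi.smul_apply, a]
    · filter_upwards [h2, Lp.coeFn_smul t v.snd] with x a c i
      have h : (t • v).snd = t • v.snd := rfl
      rw [h, c, Pi.smul_apply, PiLp.smul_apply, a i, partialDeriv, partialDeriv,
        fderiv_const_smul ((hφ.smooth.differentiable (by simp)) x)]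
      rfl

/-- `H₀¹(Ω)`: the closure of `C_c^∞(Ω)` in the `H¹` norm. An element is a pair `(y, ∇y)` of a
function `y ∈ L²(Ω)` and its weak gradient (which `y` determines). -/
def H10 {n : ℕ} (Ω : Set (E n)) : Submodule ℝ (L2Pair Ω) :=
  (testPairs Ω).topologicalClosure

/-- The underlying `L²(Ω)` function of an element of `H₀¹(Ω)`. -/
def toL2 {n : ℕ} {Ω : Set (E n)} (y : H10 Ω) : L2 Ω := (y : L2Pair Ω).fst

/-- The weak gradient of an element of `H₀¹(Ω)`. -/
def weakGrad {n : ℕ} {Ω : Set (E n)} (y : H10 Ω) : L2Vec Ω := (y : L2Pair Ω).snd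

/-- The coefficients of the operator `A y = -∑ᵢⱼ ∂ᵢ(a_ij ∂ⱼ y) + c₀ y`:
`a_ij ∈ C^{0,1}(closure Ω)`, `(a_ij)` symmetric and uniformly elliptic, `c₀ ∈ L^∞(Ω)`. -/
structure IsEllipticCoeff {n : ℕ} (Ω : Set (E n)) (a : E n → Matrix (Fin n) (Fin n) ℝ)
    (c₀ : E n → ℝ) : Prop where
  lipschitz : ∀ i j, ∃ K : ℝ≥0, LipschitzOnWith K (fun x => a x i j) (closure Ω)
  symm : ∀ x ∈ Ω, (a x).IsSymm
  elliptic : ∃ σ > (0 : ℝ), ∀ᵐ x ∂(volume.restrict Ω), ∀ ξ : E n,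
    σ * ‖ξ‖ ^ 2 ≤ ∑ i, ∑ j, a x i j * ξ i * ξ j
  bounded : MemLp c₀ ∞ (volume.restrict Ω)

/-- The bilinear form `a(y,v) = ∫_Ω ∑ᵢⱼ a_ij ∂ⱼy ∂ᵢv + c₀ y v dx`. -/
def bilin {n : ℕ} {Ω : Set (E n)} (a : E n → Matrix (Fin n) (Fin n) ℝ) (c₀ : E n → ℝ)
    (y v : H10 Ω) : ℝ :=
  ∫ x in Ω, ((∑ i, ∑ j, a x i j * weakGrad y x j * weakGrad v x i) + c₀ x * toL2 y x * toL2 v x)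

/-- `y ∈ H₀¹(Ω)` is a weak solution of `A y = g` in `Ω`, `y = 0` on the boundary. -/
def IsWeakSol {n : ℕ} {Ω : Set (E n)} (a : E n → Matrix (Fin n) (Fin n) ℝ) (c₀ : E n → ℝ)
    (y : H10 Ω) (g : L2 Ω) : Prop :=
  ∀ v : H10 Ω, bilin a c₀ y v = inner ℝ g (toL2 v)

/-- `φ ∈ H₀¹(Ω)` is a weak solution of the adjoint equation `A* φ = g` in `Ω`, `φ = 0` on the
boundary. -/
def IsWeakAdjointSol {n : ℕ} {Ω : Set (E n)} (a : E n → Matrix (Fin n) (Fin n) ℝ) (c₀ : E n → ℝ)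
    (φ : H10 Ω) (g : L2 Ω) : Prop :=
  ∀ v : H10 Ω, bilin a c₀ v φ = inner ℝ g (toL2 v)

/-- The Huber-type regularization `h_{p,γ}` of the absolute value. -/
def huber (p γ : ℝ) (v : ℝ) : ℝ :=
  if |v| ≤ 1 / γ then γ ^ (p - 1) / p * |v| ^ p else |v| + 1 / γ * ((1 - p) / p)

/-- `Υ_{p,γ}(u) = ∫_Ω h_{p,γ}(u(x))^{1/p} dx`. -/
def penalty {n : ℕ} {Ω : Set (E n)} (p γ : ℝ) (u : L2 Ω) : ℝ :=
  ∫ x in Ω, huber p γ (u x) ^ (1 / p)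

/-- `δ_γ = γ^{(p-1)/p} / p^{1/p}`. -/
def delta (p γ : ℝ) : ℝ := γ ^ ((p - 1) / p) / p ^ (1 / p)

/-- The scalar function whose superposition with `u` is `w`. -/
def wFun (p γ : ℝ) (z : ℝ) : ℝ :=
  if 1 / γ < |z| then
    (delta p γ - 1 / p * (|z| + 1 / γ * ((1 - p) / p)) ^ ((1 - p) / p)) * SignType.sign z
  else 0

/-- The objective `½‖y - y_d‖² + (α/2)‖u‖² + β Υ_{p,γ}(u)` (norms of `L²(Ω)`). -/
def cost {n : ℕ} {Ω : Set (E n)} (yd : L2 Ω) (α β p γ : ℝ) (y : H10 Ω) (u : L2 Ω) : ℝ :=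
  1 / 2 * ‖toL2 y - yd‖ ^ 2 + α / 2 * ‖u‖ ^ 2 + β * penalty p γ u

/-- `(y, u) ∈ H₀¹(Ω) × L²(Ω)` is a (global) solution of the regularized problem `(P_γ)`:
it is feasible, i.e. `A y = u + f` weakly, and it minimizes the objective among all feasible
pairs. -/
structure IsSolution {n : ℕ} {Ω : Set (E n)} (a : E n → Matrix (Fin n) (Fin n) ℝ) (c₀ : E n → ℝ)
    (f yd : L2 Ω) (α β p γ : ℝ) (y : H10 Ω) (u : L2 Ω) : Prop where
  feasible : IsWeakSol a c₀ y (u + f)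
  minimal : ∀ (z : H10 Ω) (v : L2 Ω), IsWeakSol a c₀ z (v + f) →
    cost yd α β p γ y u ≤ cost yd α β p γ z v

end SparseControl

end

/-! As a function of `|s|`, the integrand `h_{p,γ}(s)^{1/p}` is concave: linear with slope `δ_γ` up
to `1/γ`, then a shifted power `1/p`, with matching values and derivatives. So it lies below its
tangents (`huber_rpow_le_tangent`), and near `ū` the nonconvex penalty is majorized by a weighted
`L¹` norm with weight `slope`, touching at `ū`. Minimality passes to this majorant; its directional
derivative `N` at `ū` is sublinear, and `0 ≤ (ȳ - y_d, z) + α (ū, v) + N(v)` whenever `A z = v`.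

Since `c₀` has no sign, `A` may be singular and there need be no control-to-state map. By Gårding,
`R = (A + s)⁻¹` exists for some shift `s`, and `z = R g`, `v = T g = g - s R g` are admissible
directions. The inequality bounds a linear functional of `g` by `N (T g)`; Hahn–Banach and Riesz
(`exists_riesz_of_le_sublinear`) produce `q ∈ L²` dominated by `N` that represents this functional
through `T`. Domination localizes to `q = β slope(ū) sign ū` where `ū ≠ 0` and `|q| ≤ β δ_γ`
elsewhere (`ae_subgradient`). The function `-α ū - q` solves the adjoint equation in a very weak
sense, and `exists_adjoint_of_very_weak` places it in `H₀¹`. -/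

namespace SparseControl

/-- The derivative of `s ↦ h_{p,γ}(s)^{1/p}` on `s ≥ 0`, evaluated at `|r|`. -/
noncomputable def slope (p γ r : ℝ) : ℝ :=
  if 1 / γ < |r| then 1 / p * (|r| + 1 / γ * ((1 - p) / p)) ^ ((1 - p) / p) else delta p γ

/-- The one-sided directional derivative of the absolute value at `s` in the direction `h`. -/
noncomputable def dirAbs (s h : ℝ) : ℝ := if s = 0 then |h| else SignType.sign s * h

/-! ### The scalar integrand: concavity in the modulus, bounds, measurability -/

section Scalar

variable {p γ : ℝ}

lemma delta_pos (hp : 1 < p) (hγ : 0 < γ) : 0 < delta p γ := by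
  unfold delta; positivity

lemma shift_at_threshold (hp : 1 < p) (hγ : 0 < γ) :
    1 / γ + 1 / γ * ((1 - p) / p) = (γ * p)⁻¹ := by
  have : 0 < p := by linarith
  field_simp
  ring

/-- Together with `huber_at_threshold`, this is the `C¹` fit of the two branches at `1/γ`, which
makes the integrand concave in the modulus. -/
lemma slope_at_threshold (hp : 1 < p) (hγ : 0 < γ) :
    1 / p * (1 / γ + 1 / γ * ((1 - p) / p)) ^ ((1 - p) / p) = delta p γ := by
  have h0 : 0 < p := by linarith
  rw [shift_at_threshold hp hγ, Real.inv_rpow (by positivity), ← Real.rpow_neg (by positivity),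
    Real.mul_rpow hγ.le h0.le, delta]
  have e : -((1 - p) / p) = (p - 1) / p := by ring
  have e2 : (p - 1) / p = 1 - 1 / p := by field_simp
  rw [e, e2, Real.rpow_sub h0, Real.rpow_one]
  field_simp

lemma huber_at_threshold (hp : 1 < p) (hγ : 0 < γ) :
    (1 / γ + 1 / γ * ((1 - p) / p)) ^ (1 / p) = delta p γ * (1 / γ) := by
  have h0 : 0 < p := by linarith
  rw [shift_at_threshold hp hγ, Real.inv_rpow (by positivity), Real.mul_rpow hγ.le h0.le, delta]
  have e2 : (p - 1) / p = 1 - 1 / p := by field_simp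
  rw [e2, Real.rpow_sub hγ, Real.rpow_one]
  field_simp

lemma slope_nonneg (hp : 1 < p) (hγ : 0 < γ) (r : ℝ) : 0 ≤ slope p γ r := by
  unfold slope
  split_ifs with h
  · have h1 := shift_at_threshold hp hγ
    have : 0 < (γ * p)⁻¹ := by positivity
    have : 0 ≤ |r| + 1 / γ * ((1 - p) / p) := by linarith
    positivity
  · exact (delta_pos hp hγ).le

lemma slope_le_delta (hp : 1 < p) (hγ : 0 < γ) (r : ℝ) : slope p γ r ≤ delta p γ := by
  unfold slope
  split_ifs with h
  · rw [← slope_at_threshold hp hγ]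
    have h1 := shift_at_threshold hp hγ
    have : 0 < (γ * p)⁻¹ := by positivity
    gcongr 1 / p * ?_
    apply Real.rpow_le_rpow_of_nonpos (by linarith) (by linarith)
    exact div_nonpos_of_nonpos_of_nonneg (by linarith) (by linarith)
  · exact le_rfl

lemma slope_zero (hγ : 0 < γ) : slope p γ 0 = delta p γ := by
  have : ¬ (1 / γ < |(0 : ℝ)|) := by rw [abs_zero, not_lt]; positivity
  simp only [slope, if_neg this]

/-- Concavity of `y ↦ y ^ θ`, from Bernoulli's inequality at `y / x - 1`. -/
lemma rpow_le_tangent {θ x y : ℝ} (h0 : 0 ≤ θ) (h1 : θ ≤ 1) (hx : 0 < x) (hy : 0 ≤ y) :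
    y ^ θ ≤ x ^ θ + θ * x ^ (θ - 1) * (y - x) := by
  have h := _root_.rpow_one_add_le_one_add_mul_self (s := y / x - 1)
    (by have : 0 ≤ y / x := by positivity
        linarith) h0 h1
  rw [add_sub_cancel, Real.div_rpow hy hx.le, div_le_iff₀ (by positivity)] at h
  refine h.trans_eq ?_
  rw [Real.rpow_sub_one hx.ne']
  field_simp

lemma huber_rpow_of_le (hp : 1 < p) (hγ : 0 < γ) {s : ℝ} (hs : |s| ≤ 1 / γ) :
    huber p γ s ^ (1 / p) = delta p γ * |s| := by
  have h0 : 0 < p := by linarith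
  rw [huber, if_pos hs, Real.mul_rpow (by positivity) (by positivity),
    ← Real.rpow_mul (abs_nonneg s), mul_one_div_cancel h0.ne', Real.rpow_one,
    Real.div_rpow (by positivity) h0.le, ← Real.rpow_mul hγ.le, delta, mul_one_div]

lemma huber_rpow_of_lt {s : ℝ} (hs : 1 / γ < |s|) :
    huber p γ s ^ (1 / p) = (|s| + 1 / γ * ((1 - p) / p)) ^ (1 / p) := by
  rw [huber, if_neg (not_le.mpr hs)]

/-- Concavity in `|s|`. When `r` and `s` lie on different branches, the power-branch tangent
inequality is applied with `1/γ` as one endpoint, where the branches fit together. -/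
lemma huber_rpow_le_tangent (hp : 1 < p) (hγ : 0 < γ) (r s : ℝ) :
    huber p γ s ^ (1 / p) ≤ huber p γ r ^ (1 / p) + slope p γ r * (|s| - |r|) := by
  have hp0 : 0 < p := by linarith
  have hshift := shift_at_threshold hp hγ
  have hpos : 0 < (γ * p)⁻¹ := by positivity
  have tangent : ∀ x y : ℝ, 1 / γ ≤ x → 1 / γ ≤ y →
      (y + 1 / γ * ((1 - p) / p)) ^ (1 / p) ≤ (x + 1 / γ * ((1 - p) / p)) ^ (1 / p) +
        1 / p * (x + 1 / γ * ((1 - p) / p)) ^ ((1 - p) / p) * (y - x) := by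
    intro x y hx hy
    have h := rpow_le_tangent (θ := 1 / p) (x := x + 1 / γ * ((1 - p) / p))
      (y := y + 1 / γ * ((1 - p) / p)) (by positivity)
      (by rw [div_le_one hp0]; exact hp.le) (by linarith) (by linarith)
    have e : 1 / p - 1 = (1 - p) / p := by field_simp
    rw [e] at h
    refine h.trans_eq ?_
    ring
  rcases le_or_gt |r| (1 / γ) with hr | hr <;> rcases le_or_gt |s| (1 / γ) with hs | hs
  · rw [huber_rpow_of_le hp hγ hr, huber_rpow_of_le hp hγ hs, slope, if_neg (not_lt.mpr hr)]
    exact le_of_eq (by ring)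
  · rw [huber_rpow_of_le hp hγ hr, huber_rpow_of_lt hs, slope, if_neg (not_lt.mpr hr)]
    have h := tangent (1 / γ) |s| le_rfl hs.le
    rw [huber_at_threshold hp hγ, slope_at_threshold hp hγ] at h
    linarith
  -- The tangent at `|r|` is compared at `1/γ`; going on down to `|s|`, the integrand falls at rate
  -- `δ_γ`, at least as fast as the tangent.
  · have h := tangent |r| (1 / γ) hr.le le_rfl
    rw [huber_at_threshold hp hγ] at h
    have h2 := slope_le_delta hp hγ r
    rw [huber_rpow_of_lt hr, huber_rpow_of_le hp hγ hs]
    rw [slope, if_pos hr] at h2 ⊢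
    nlinarith
  · rw [huber_rpow_of_lt hr, huber_rpow_of_lt hs, slope, if_pos hr]
    exact tangent _ _ hr.le hs.le

lemma huber_nonneg (hp : 1 < p) (hγ : 0 < γ) (s : ℝ) : 0 ≤ huber p γ s := by
  have hp0 : 0 < p := by linarith
  unfold huber
  split_ifs with h
  · positivity
  · have := shift_at_threshold hp hγ
    have : 0 < (γ * p)⁻¹ := by positivity
    linarith

lemma huber_rpow_le (hp : 1 < p) (hγ : 0 < γ) (s : ℝ) :
    huber p γ s ^ (1 / p) ≤ delta p γ * |s| := by
  have h := huber_rpow_le_tangent hp hγ 0 s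
  rw [slope_zero hγ, huber_rpow_of_le hp hγ (s := 0) (by rw [abs_zero]; positivity)] at h
  simpa using h

lemma wFun_eq (z : ℝ) : wFun p γ z = (delta p γ - slope p γ z) * SignType.sign z := by
  unfold wFun slope
  split_ifs <;> simp

lemma measurable_huber : Measurable (huber p γ) := by
  unfold huber
  refine Measurable.ite (measurableSet_le (by fun_prop) (by fun_prop)) ?_ ?_ <;> fun_prop

lemma measurable_slope : Measurable (slope p γ) := by
  unfold slope
  refine Measurable.ite (measurableSet_lt (by fun_prop) (by fun_prop)) ?_ ?_ <;> fun_prop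

lemma measurable_sign : Measurable fun z : ℝ => ((SignType.sign z : SignType) : ℝ) := by
  have : (fun z : ℝ => ((SignType.sign z : SignType) : ℝ)) =
      fun z => if 0 < z then 1 else if z < 0 then -1 else 0 := by
    funext z
    rw [sign_apply]
    split_ifs <;> simp
  rw [this]
  exact Measurable.ite (measurableSet_lt (by fun_prop) (by fun_prop)) measurable_const
    (Measurable.ite (measurableSet_lt (by fun_prop) (by fun_prop)) measurable_const
      measurable_const)

lemma abs_sign_le (z : ℝ) : |((SignType.sign z : SignType) : ℝ)| ≤ 1 := by
  rcases lt_trichotomy z 0 with h | h | h <;> simp [h, sign_neg, sign_pos]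

lemma measurable_wFun : Measurable (wFun p γ) := by
  rw [funext wFun_eq]
  exact (measurable_const.sub measurable_slope).mul measurable_sign

lemma abs_wFun_le (hp : 1 < p) (hγ : 0 < γ) (z : ℝ) : |wFun p γ z| ≤ delta p γ := by
  rw [wFun_eq, abs_mul]
  have h1 := slope_nonneg hp hγ z
  have h2 := slope_le_delta hp hγ z
  rw [abs_of_nonneg (by linarith)]
  nlinarith [abs_sign_le z, abs_nonneg ((SignType.sign z : SignType) : ℝ)]

end Scalar

/-! ### Directional derivative of the absolute value -/

section DirAbs

lemma abs_dirAbs_le (s h : ℝ) : |dirAbs s h| ≤ |h| := by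
  unfold dirAbs
  split_ifs
  · simp
  · rw [abs_mul]
    exact mul_le_of_le_one_left (abs_nonneg h) (abs_sign_le s)

lemma dirAbs_add_le (s h k : ℝ) : dirAbs s (h + k) ≤ dirAbs s h + dirAbs s k := by
  unfold dirAbs
  split_ifs
  · exact abs_add_le h k
  · rw [mul_add]

lemma dirAbs_mul {c : ℝ} (hc : 0 ≤ c) (s h : ℝ) : dirAbs s (c * h) = c * dirAbs s h := by
  unfold dirAbs
  split_ifs
  · rw [abs_mul, abs_of_nonneg hc]
  · ring

lemma dirAbs_zero (s : ℝ) : dirAbs s 0 = 0 := by simp [dirAbs]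

lemma measurable_dirAbs : Measurable fun z : ℝ × ℝ => dirAbs z.1 z.2 := by
  unfold dirAbs
  exact Measurable.ite (measurable_fst (measurableSet_singleton 0)) (by fun_prop)
    ((measurable_sign.comp measurable_fst).mul measurable_snd)

lemma tendsto_abs_slope (s h : ℝ) :
    Tendsto (fun t : ℝ => (|s + t * h| - |s|) / t) (𝓝[>] 0) (𝓝 (dirAbs s h)) := by
  by_cases hs : s = 0
  · subst hs
    refine tendsto_const_nhds.congr' ?_
    filter_upwards [self_mem_nhdsWithin] with t ht
    have ht : 0 < t := ht
    rw [zero_add, abs_mul, abs_of_pos ht, abs_zero, sub_zero, mul_div_cancel_left₀ _ ht.ne']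
    simp [dirAbs]
  · have h1 : HasDerivAt (fun t : ℝ => |s + t * h|) (SignType.sign s * h) 0 := by
      have e : HasDerivAt (fun t : ℝ => s + t * h) h 0 := by
        simpa using ((hasDerivAt_id (0 : ℝ)).mul_const h).const_add s
      have := HasDerivAt.comp (0 : ℝ) (h₂ := fun x : ℝ => |x|) (h := fun t : ℝ => s + t * h)
        (by simpa using hasDerivAt_abs hs) e
      exact this
    have h2 := h1.tendsto_slope_zero_right
    simp only [zero_add, zero_mul, add_zero, smul_eq_mul] at h2
    rw [dirAbs, if_neg hs]
    refine h2.congr fun t => ?_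
    rw [div_eq_inv_mul]

end DirAbs

/-! ### Integral majorant, its differentiation, and pointwise subgradients -/

section Integrals

variable {X : Type*} [MeasurableSpace X] {μ : Measure X} {p γ : ℝ} {u v : X → ℝ}

lemma aestronglyMeasurable_slope (hu : AEStronglyMeasurable u μ) :
    AEStronglyMeasurable (fun x => slope p γ (u x)) μ :=
  (measurable_slope.comp_aemeasurable hu.aemeasurable).aestronglyMeasurable

lemma integrable_slope_mul (hp : 1 < p) (hγ : 0 < γ) (hu : AEStronglyMeasurable u μ)
    (hv : Integrable v μ) : Integrable (fun x => slope p γ (u x) * v x) μ :=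
  hv.bdd_mul (c := delta p γ) (aestronglyMeasurable_slope hu) <| .of_forall fun x => by
    rw [Real.norm_eq_abs, abs_of_nonneg (slope_nonneg hp hγ _)]
    exact slope_le_delta hp hγ _

lemma integrable_dirAbs (hu : AEStronglyMeasurable u μ) (hv : Integrable v μ) :
    Integrable (fun x => dirAbs (u x) (v x)) μ :=
  hv.mono (measurable_dirAbs.comp_aemeasurable
      (hu.aemeasurable.prodMk hv.aemeasurable)).aestronglyMeasurable
    (.of_forall fun _ => abs_dirAbs_le _ _)

lemma integrable_huber_rpow (hp : 1 < p) (hγ : 0 < γ) (hu : Integrable u μ) :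
    Integrable (fun x => huber p γ (u x) ^ (1 / p)) μ := by
  refine (hu.abs.const_mul (delta p γ)).mono' ?_ (.of_forall fun x => ?_)
  · exact ((measurable_huber.comp_aemeasurable hu.aemeasurable).pow_const _).aestronglyMeasurable
  · rw [Real.norm_eq_abs, abs_of_nonneg (Real.rpow_nonneg (huber_nonneg hp hγ _) _)]
    exact huber_rpow_le hp hγ _

lemma integral_huber_rpow_le (hp : 1 < p) (hγ : 0 < γ) (hu : Integrable u μ)
    (hv : Integrable v μ) :
    ∫ x, huber p γ (v x) ^ (1 / p) ∂μ ≤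
      ∫ x, huber p γ (u x) ^ (1 / p) ∂μ + ∫ x, slope p γ (u x) * (|v x| - |u x|) ∂μ := by
  have h : Integrable (fun x => slope p γ (u x) * (|v x| - |u x|)) μ :=
    integrable_slope_mul hp hγ hu.1 (hv.abs.sub hu.abs)
  rw [← integral_add (integrable_huber_rpow hp hγ hu) h]
  exact integral_mono (integrable_huber_rpow hp hγ hv) ((integrable_huber_rpow hp hγ hu).add h)
    fun x => huber_rpow_le_tangent hp hγ _ _

/-- Dominated convergence: by the reverse triangle inequality the difference quotients are at most
`|v|`, and the weight is at most `δ_γ`. -/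
lemma tendsto_integral_slope_mul (hp : 1 < p) (hγ : 0 < γ) (hu : Integrable u μ)
    (hv : Integrable v μ) :
    Tendsto (fun t : ℝ => ∫ x, slope p γ (u x) * ((|u x + t * v x| - |u x|) / t) ∂μ) (𝓝[>] 0)
      (𝓝 (∫ x, slope p γ (u x) * dirAbs (u x) (v x) ∂μ)) := by
  refine tendsto_integral_filter_of_dominated_convergence (fun x => delta p γ * |v x|) ?_ ?_
    (hv.abs.const_mul _) (.of_forall fun x => (tendsto_abs_slope _ _).const_mul _)
  · refine .of_forall fun t => ?_
    exact (integrable_slope_mul hp hγ hu.1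
      (((hu.add (hv.const_mul t)).abs.sub hu.abs).div_const t)).1
  · filter_upwards [self_mem_nhdsWithin] with t (ht : 0 < t)
    refine .of_forall fun x => ?_
    rw [norm_mul, Real.norm_eq_abs, Real.norm_eq_abs, abs_of_nonneg (slope_nonneg hp hγ _)]
    refine mul_le_mul (slope_le_delta hp hγ _) ?_ (abs_nonneg _) (delta_pos hp hγ).le
    rw [abs_div, abs_of_pos ht, div_le_iff₀ ht]
    refine (abs_abs_sub_abs_le _ _).trans_eq ?_
    rw [add_sub_cancel_left, abs_mul, abs_of_pos ht, mul_comm]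

/-- An element of `L²` dominated by `v ↦ ∫ g · dirAbs u v` is pointwise a subgradient of
`g |·|` at `u`. -/
lemma ae_subgradient [IsFiniteMeasure μ] {g : X → ℝ} (u q : Lp ℝ 2 μ)
    (hg : ∀ v : X → ℝ, Integrable v μ → Integrable (fun x => g x * dirAbs (u x) (v x)) μ)
    (h : ∀ v : Lp ℝ 2 μ, inner ℝ q v ≤ ∫ x, g x * dirAbs (u x) (v x) ∂μ) :
    ∀ᵐ x ∂μ, (u x ≠ 0 → q x = g x * SignType.sign (u x)) ∧ (u x = 0 → |q x| ≤ g x) := by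
  -- Testing with `c` times indicator functions localizes the integral inequality; `c = 1` and `c =
  -- -1` suffice.
  have key : ∀ c : ℝ, ∀ᵐ x ∂μ, q x * c ≤ g x * dirAbs (u x) c := by
    intro c
    have hq : Integrable (fun x => q x * c) μ :=
      ((Lp.memLp q).integrable one_le_two).mul_const c
    refine ae_le_of_forall_setIntegral_le hq (hg _ (integrable_const c)) fun s hs hμs => ?_
    have h1 := h (indicatorConstLp 2 hs hμs.ne c)
    have e1 : inner ℝ q (indicatorConstLp 2 hs hμs.ne c) = ∫ x in s, q x * c ∂μ := by
      rw [real_inner_comm, L2.inner_indicatorConstLp_eq_setIntegral_inner]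
      rfl
    rw [e1] at h1
    refine h1.trans_eq ?_
    rw [← integral_indicator hs]
    refine integral_congr_ae ?_
    filter_upwards [indicatorConstLp_coeFn (p := 2) (hs := hs) (hμs := hμs.ne) (c := c)] with x hx
    rw [hx]
    by_cases hxs : x ∈ s <;> simp [hxs, dirAbs_zero]
  filter_upwards [key 1, key (-1)] with x h1 h2
  unfold dirAbs at h1 h2
  constructor
  · intro hx
    rw [if_neg hx] at h1 h2
    linarith
  · intro hx
    rw [if_pos hx] at h1 h2
    rw [abs_le]
    simp only [abs_neg, abs_one] at h1 h2
    constructor <;> linarith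

end Integrals

/-! ### Abstract duality and weighted forms on `L²` -/

/-- Hahn–Banach and Riesz: a functional `ℓ` on the source of `T` with `ℓ x ≤ N (T x)` for a
sublinear `N` factors through `T` by an element of the Hilbert space dominated by `N`. -/
lemma exists_riesz_of_le_sublinear {V H : Type*} [AddCommGroup V] [Module ℝ V]
    [NormedAddCommGroup H] [InnerProductSpace ℝ H] [CompleteSpace H]
    (T : V →ₗ[ℝ] H) (l : V →ₗ[ℝ] ℝ) (N : H → ℝ) (C : ℝ)
    (N_hom : ∀ c : ℝ, 0 < c → ∀ x, N (c • x) = c * N x) (N_add : ∀ x y, N (x + y) ≤ N x + N y)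
    (N_le : ∀ x, N x ≤ C * ‖x‖) (h : ∀ x, l x ≤ N (T x)) :
    ∃ q : H, (∀ x, inner ℝ q x ≤ N x) ∧ ∀ x, inner ℝ q (T x) = l x := by
  -- On the kernel, `l` is at most `N 0 ≤ 0` at both `x` and `-x`, so `l` descends to the range of
  -- `T`; injectivity of `T` is not needed.
  have hker : LinearMap.ker T ≤ LinearMap.ker l := by
    intro x hx
    have hx : T x = 0 := hx
    have h0 : N 0 ≤ 0 := by simpa using N_le 0
    have h1 := h x
    have h2 := h (-x)
    rw [map_neg, map_neg, hx, neg_zero] at h2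
    rw [hx] at h1
    exact le_antisymm (by linarith) (by linarith)
  let m : LinearMap.range T →ₗ[ℝ] ℝ :=
    ((LinearMap.ker T).liftQ l hker).comp T.quotKerEquivRange.symm.toLinearMap
  have hm : ∀ x, m ⟨T x, x, rfl⟩ = l x := by
    intro x
    have : T.quotKerEquivRange.symm ⟨T x, x, rfl⟩ = (LinearMap.ker T).mkQ x :=
      T.quotKerEquivRange_symm_apply_image x _
    simp only [m, LinearMap.comp_apply, LinearEquiv.coe_coe, this]
    exact Submodule.liftQ_apply _ _ _
  obtain ⟨g, hg, hgN⟩ := exists_extension_of_le_sublinear ⟨LinearMap.range T, m⟩ N N_hom N_add (by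
    rintro ⟨_, x, rfl⟩
    exact (hm x).trans_le (h x))
  have hbound : ∀ x, ‖g x‖ ≤ C * ‖x‖ := by
    intro x
    rw [Real.norm_eq_abs, abs_le]
    have h1 := (hgN x).trans (N_le x)
    have h2 := (hgN (-x)).trans (N_le (-x))
    rw [map_neg, norm_neg] at h2
    exact ⟨by linarith, h1⟩
  refine ⟨(InnerProductSpace.toDual ℝ H).symm (g.mkContinuous C hbound), fun x => ?_, fun x => ?_⟩
  · rw [InnerProductSpace.toDual_symm_apply]
    exact hgN x
  · rw [InnerProductSpace.toDual_symm_apply]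
    exact (hg ⟨T x, x, rfl⟩).trans (hm x)

/-- A bounded weight defines a continuous bilinear form on `L²`. -/
lemma exists_weighted_form {X : Type*} [MeasurableSpace X] {μ : Measure X} {m : X → ℝ}
    (hm : MemLp m ∞ μ) : ∃ B : Lp ℝ 2 μ →L[ℝ] Lp ℝ 2 μ →L[ℝ] ℝ, ∀ f g,
      Integrable (fun x => m x * f x * g x) μ ∧ B f g = ∫ x, m x * f x * g x ∂μ := by
  let M : Lp ℝ 2 μ →L[ℝ] Lp ℝ 2 μ :=
    (ContinuousLinearMap.mul ℝ ℝ).holderL μ ∞ 2 2 (hm.toLp m)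
  have hM : ∀ f g : Lp ℝ 2 μ, (fun x => inner ℝ (M f x) (g x)) =ᵐ[μ]
      fun x => m x * f x * g x := by
    intro f g
    have h1 : M f =ᵐ[μ] _ := (ContinuousLinearMap.mul ℝ ℝ).coeFn_holder (r := 2) (hm.toLp m) f
    filter_upwards [h1, hm.coeFn_toLp] with x hx hx2
    rw [hx, hx2]
    simp [mul_comm]
  refine ⟨(innerSL ℝ).comp M, fun f g => ⟨?_, ?_⟩⟩
  · exact (integrable_congr (hM f g)).1 (L2.integrable_inner (M f) g)
  · rw [ContinuousLinearMap.comp_apply, innerSL_apply_apply, L2.inner_def]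
    exact integral_congr_ae (hM f g)

/-! ### The elliptic form, Gårding's inequality and the resolvent -/

variable {n : ℕ} {Ω : Set (E n)} {a : E n → Matrix (Fin n) (Fin n) ℝ} {c₀ : E n → ℝ}

instance : CompleteSpace (H10 Ω) := Submodule.topologicalClosure.completeSpace _

lemma isFiniteMeasure_restrict (hΩ : IsBoundedLipschitzDomain Ω) :
    IsFiniteMeasure (volume.restrict Ω) :=
  ⟨by rw [Measure.restrict_apply_univ]; exact hΩ.isBounded.measure_lt_top⟩

/-- The embedding of `H₀¹(Ω)` in `L²(Ω)`. -/
noncomputable def toL2CLM (Ω : Set (E n)) : H10 Ω →L[ℝ] L2 Ω :=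
  (WithLp.fstL 2 ℝ (L2 Ω) (L2Vec Ω)).comp (H10 Ω).subtypeL

lemma toL2CLM_apply (y : H10 Ω) : toL2CLM Ω y = toL2 y := rfl

/-- The `i`-th component of the weak gradient. -/
noncomputable def gradCLM (Ω : Set (E n)) (i : Fin n) : H10 Ω →L[ℝ] L2 Ω :=
  ((EuclideanSpace.proj i : E n →L[ℝ] ℝ).compLpL 2 (volume.restrict Ω)).comp
    ((WithLp.sndL 2 ℝ (L2 Ω) (L2Vec Ω)).comp (H10 Ω).subtypeL)

lemma gradCLM_ae (y : H10 Ω) (i : Fin n) :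
    ∀ᵐ x ∂(volume.restrict Ω), gradCLM Ω i y x = weakGrad y x i :=
  ContinuousLinearMap.coeFn_compLp (EuclideanSpace.proj i : E n →L[ℝ] ℝ) (weakGrad y)

lemma memLp_coeff (hΩ : IsBoundedLipschitzDomain Ω) (hA : IsEllipticCoeff Ω a c₀) (i j : Fin n) :
    MemLp (fun x => a x i j) ∞ (volume.restrict Ω) := by
  obtain ⟨K, hK⟩ := hA.lipschitz i j
  have hc : IsCompact (closure Ω) := hΩ.isBounded.isCompact_closure
  obtain ⟨C, hC⟩ := hc.exists_bound_of_continuousOn hK.continuousOn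
  have hm := hΩ.isOpen.measurableSet
  exact memLp_top_of_bound ((hK.continuousOn.mono subset_closure).aestronglyMeasurable hm) C
    ((ae_restrict_mem hm).mono fun x hx => hC x (subset_closure hx))

lemma exists_continuous_bilin (hΩ : IsBoundedLipschitzDomain Ω) (hA : IsEllipticCoeff Ω a c₀) :
    ∃ B : H10 Ω →L[ℝ] H10 Ω →L[ℝ] ℝ, ∀ y v,
      B y v = bilin a c₀ y v ∧ Integrable (fun x => (∑ i, ∑ j, a x i j * weakGrad y x j *
        weakGrad v x i) + c₀ x * toL2 y x * toL2 v x) (volume.restrict Ω) := by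
  choose M hM using fun i j => exists_weighted_form (memLp_coeff hΩ hA i j)
  obtain ⟨M₀, hM₀⟩ := exists_weighted_form hA.bounded
  refine ⟨(∑ i, ∑ j, (M i j).bilinearComp (gradCLM Ω j) (gradCLM Ω i)) +
    M₀.bilinearComp (toL2CLM Ω) (toL2CLM Ω), fun y v => ?_⟩
  have hterm : ∀ i j, (fun x => a x i j * gradCLM Ω j y x * gradCLM Ω i v x)
      =ᵐ[volume.restrict Ω] fun x => a x i j * weakGrad y x j * weakGrad v x i := by
    intro i j
    filter_upwards [gradCLM_ae y j, gradCLM_ae v i] with x h1 h2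
    rw [h1, h2]
  have hint : ∀ i j, Integrable (fun x => a x i j * weakGrad y x j * weakGrad v x i)
      (volume.restrict Ω) := fun i j => (integrable_congr (hterm i j)).1 (hM i j _ _).1
  have hint₀ : Integrable (fun x => c₀ x * toL2 y x * toL2 v x) (volume.restrict Ω) :=
    (hM₀ (toL2 y) (toL2 v)).1
  have hsum : Integrable (fun x => ∑ i, ∑ j, a x i j * weakGrad y x j * weakGrad v x i)
      (volume.restrict Ω) :=
    integrable_finsetSum _ fun i _ => integrable_finsetSum _ fun j _ => hint i j
  refine ⟨?_, hsum.add hint₀⟩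
  rw [bilin, integral_add hsum hint₀,
    integral_finsetSum _ fun i _ => integrable_finsetSum _ fun j _ => hint i j]
  simp only [add_apply, sum_apply,
    ContinuousLinearMap.bilinearComp_apply, (hM _ _ _ _).2, (hM₀ _ _).2, toL2CLM_apply]
  congr 1
  refine Finset.sum_congr rfl fun i _ => ?_
  rw [integral_finsetSum _ fun j _ => hint i j]
  exact Finset.sum_congr rfl fun j _ => integral_congr_ae (hterm i j)

/-- Symmetry of `a_ij` makes `A` formally self-adjoint, so the same resolvent serves the adjoint
equation. -/
lemma bilin_comm (hΩ : IsBoundedLipschitzDomain Ω) (hA : IsEllipticCoeff Ω a c₀) (y v : H10 Ω) :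
    bilin a c₀ y v = bilin a c₀ v y := by
  refine integral_congr_ae ?_
  filter_upwards [ae_restrict_mem hΩ.isOpen.measurableSet] with x hx
  congr 1
  · rw [Finset.sum_comm]
    refine Finset.sum_congr rfl fun j _ => Finset.sum_congr rfl fun i _ => ?_
    rw [(hA.symm x hx).apply]
    ring
  · ring

lemma L2_norm_sq {F : Type*} [NormedAddCommGroup F] [InnerProductSpace ℝ F] {X : Type*}
    [MeasurableSpace X] {μ : Measure X} (f : Lp F 2 μ) :
    Integrable (fun x => ‖f x‖ ^ 2) μ ∧ ‖f‖ ^ 2 = ∫ x, ‖f x‖ ^ 2 ∂μ := by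
  have h := L2.integrable_inner (𝕜 := ℝ) f f
  have e := L2.inner_def (𝕜 := ℝ) f f
  simp only [real_inner_self_eq_norm_sq] at h e
  exact ⟨h, e⟩

/-- Gårding's inequality. -/
lemma exists_garding (hΩ : IsBoundedLipschitzDomain Ω) (hA : IsEllipticCoeff Ω a c₀) :
    ∃ σ > 0, ∃ s : ℝ, ∀ y : H10 Ω, σ * ‖y‖ ^ 2 ≤ bilin a c₀ y y + s * ‖toL2 y‖ ^ 2 := by
  obtain ⟨B, hB⟩ := exists_continuous_bilin hΩ hA
  obtain ⟨σ, hσ, hell⟩ := hA.elliptic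
  obtain ⟨C, hbound⟩ : ∃ C, ∀ᵐ x ∂(volume.restrict Ω), ‖c₀ x‖ ≤ C := by
    have h := hA.bounded.2
    rw [eLpNorm_exponent_top] at h
    refine ⟨(eLpNormEssSup c₀ (volume.restrict Ω)).toReal, ?_⟩
    filter_upwards [ae_le_eLpNormEssSup (f := c₀) (μ := volume.restrict Ω)] with x hx
    rw [← toReal_enorm]
    exact ENNReal.toReal_mono h.ne hx
  -- In the shift, `σ` supplies the `L²` part of the `H¹` norm and `C` absorbs the negative part of
  -- `c₀`.
  refine ⟨σ, hσ, σ + C, fun y => ?_⟩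
  obtain ⟨i1, e1⟩ := L2_norm_sq (toL2 y)
  obtain ⟨i2, e2⟩ := L2_norm_sq (weakGrad y)
  have e : ‖y‖ ^ 2 = ‖toL2 y‖ ^ 2 + ‖weakGrad y‖ ^ 2 :=
    WithLp.prod_norm_sq_eq_of_L2 (y : L2Pair Ω)
  rw [e, e1, e2, bilin, ← integral_add i1 i2, ← integral_const_mul, ← integral_const_mul,
    ← integral_add (hB y y).2 (i1.const_mul _)]
  refine integral_mono_ae ((i1.add i2).const_mul _) ((hB y y).2.add (i1.const_mul _)) ?_
  filter_upwards [hell, hbound] with x h1 h2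
  have h3 : ∑ i, ∑ j, a x i j * weakGrad y x j * weakGrad y x i =
      ∑ i, ∑ j, a x i j * weakGrad y x i * weakGrad y x j :=
    Finset.sum_congr rfl fun i _ => Finset.sum_congr rfl fun j _ => by ring
  have h4 := h1 (weakGrad y x)
  have h5 := (abs_le.1 h2).1
  simp only [Real.norm_eq_abs, sq_abs] at h4 ⊢
  rw [h3]
  nlinarith [sq_nonneg (toL2 y x)]

/-- The resolvent `(A + s)⁻¹ : L²(Ω) → H₀¹(Ω)` for some shift `s`. -/
lemma exists_resolvent (hΩ : IsBoundedLipschitzDomain Ω) (hA : IsEllipticCoeff Ω a c₀) :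
    ∃ (s : ℝ) (R : L2 Ω →L[ℝ] H10 Ω), ∀ g v,
      bilin a c₀ (R g) v + s * inner ℝ (toL2 (R g)) (toL2 v) = inner ℝ g (toL2 v) := by
  obtain ⟨B, hB⟩ := exists_continuous_bilin hΩ hA
  obtain ⟨σ, hσ, s, hs⟩ := exists_garding hΩ hA
  let I : L2 Ω →L[ℝ] L2 Ω →L[ℝ] ℝ := innerSL ℝ
  let B' : H10 Ω →L[ℝ] H10 Ω →L[ℝ] ℝ := B + s • I.bilinearComp (toL2CLM Ω) (toL2CLM Ω)
  have hB' : ∀ y v, B' y v = bilin a c₀ y v + s * inner ℝ (toL2 y) (toL2 v) := by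
    intro y v
    rw [← (hB y v).1]
    rfl
  have hco : IsCoercive B' := by
    refine ⟨σ, hσ, fun y => ?_⟩
    rw [hB', real_inner_self_eq_norm_sq, mul_assoc, ← sq]
    exact hs y
  -- Lax–Milgram; the adjoint of the embedding turns `g` into the Riesz representative of `v ↦ (g,
  -- v)` on `H₀¹(Ω)`.
  refine ⟨s, hco.continuousLinearEquivOfBilin.symm.toContinuousLinearMap.comp
    (toL2CLM Ω).adjoint, fun g v => ?_⟩
  rw [← hB', ← hco.continuousLinearEquivOfBilin_apply]
  simp only [ContinuousLinearMap.comp_apply, ContinuousLinearEquiv.coe_coe,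
    ContinuousLinearEquiv.apply_symm_apply]
  rw [ContinuousLinearMap.adjoint_inner_left, toL2CLM_apply]

/-! ### First-order conditions and regularity of the adjoint state -/

/-- The sublinear majorant of the directional derivative of `β Υ_{p,γ}` at `u`. -/
noncomputable def penaltyDir (β p γ : ℝ) (u v : L2 Ω) : ℝ :=
  ∫ x in Ω, β * slope p γ (u x) * dirAbs (u x) (v x)

lemma integrable_of_L2 [IsFiniteMeasure (volume.restrict Ω)] (u : L2 Ω) :
    Integrable u (volume.restrict Ω) :=
  (Lp.memLp u).integrable one_le_two

section

variable {β p γ : ℝ}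

lemma integrable_penaltyDir (hp : 1 < p) (hγ : 0 < γ) [IsFiniteMeasure (volume.restrict Ω)]
    (u : L2 Ω) {v : E n → ℝ} (hv : Integrable v (volume.restrict Ω)) :
    Integrable (fun x => β * slope p γ (u x) * dirAbs (u x) (v x)) (volume.restrict Ω) := by
  simp only [mul_assoc]
  exact (integrable_slope_mul hp hγ (integrable_of_L2 u).1
    (integrable_dirAbs (integrable_of_L2 u).1 hv)).const_mul β

lemma penaltyDir_add_le (hβ : 0 < β) (hp : 1 < p) (hγ : 0 < γ)
    [IsFiniteMeasure (volume.restrict Ω)] (u v w : L2 Ω) :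
    penaltyDir β p γ u (v + w) ≤ penaltyDir β p γ u v + penaltyDir β p γ u w := by
  have h1 := integrable_penaltyDir (β := β) hp hγ u (integrable_of_L2 v)
  have h2 := integrable_penaltyDir (β := β) hp hγ u (integrable_of_L2 w)
  unfold penaltyDir
  rw [← integral_add h1 h2]
  refine integral_mono_ae (integrable_penaltyDir hp hγ u (integrable_of_L2 (v + w))) (h1.add h2) ?_
  filter_upwards [Lp.coeFn_add v w] with x hx
  simp only [Pi.add_apply, hx]
  rw [← mul_add]
  exact mul_le_mul_of_nonneg_left (dirAbs_add_le _ _ _)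
    (mul_nonneg hβ.le (slope_nonneg hp hγ _))

lemma penaltyDir_smul (u v : L2 Ω) {c : ℝ} (hc : 0 < c) :
    penaltyDir β p γ u (c • v) = c * penaltyDir β p γ u v := by
  unfold penaltyDir
  rw [← integral_const_mul]
  refine integral_congr_ae ?_
  filter_upwards [Lp.coeFn_smul c v] with x hx
  rw [hx, Pi.smul_apply, smul_eq_mul, dirAbs_mul hc.le]
  ring

/-- Cauchy–Schwarz against the constant `β δ_γ`, which is in `L²` because the measure is finite. -/
lemma exists_penaltyDir_le (hβ : 0 < β) (hp : 1 < p) (hγ : 0 < γ)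
    [IsFiniteMeasure (volume.restrict Ω)] (u : L2 Ω) :
    ∃ C, ∀ v, penaltyDir β p γ u v ≤ C * ‖v‖ := by
  refine ⟨‖Lp.const 2 (volume.restrict Ω) (β * delta p γ)‖, fun v => ?_⟩
  rw [← norm_abs_eq_norm v]
  refine le_trans ?_ (real_inner_le_norm _ _)
  rw [L2.inner_def]
  refine integral_mono_ae (integrable_penaltyDir hp hγ u (integrable_of_L2 v))
    (L2.integrable_inner _ _) ?_
  filter_upwards [Lp.coeFn_abs v, Lp.coeFn_const 2 (volume.restrict Ω) (β * delta p γ)]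
    with x h1 h2
  simp only [h1, h2, Function.const_apply]
  have h3 := slope_nonneg hp hγ (u x)
  have h4 : slope p γ (u x) * dirAbs (u x) (v x) ≤ delta p γ * |v x| :=
    (mul_le_mul_of_nonneg_left ((le_abs_self _).trans (abs_dirAbs_le _ _)) h3).trans
      (mul_le_mul_of_nonneg_right (slope_le_delta hp hγ _) (abs_nonneg _))
  have h5 : inner ℝ (β * delta p γ) |v x| = β * (delta p γ * |v x|) := by
    simp; ring
  rw [h5, mul_assoc]
  exact mul_le_mul_of_nonneg_left h4 hβ.le

end

/-- The variational inequality satisfied by a minimizer. -/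
lemma IsSolution.variational_inequality (hΩ : IsBoundedLipschitzDomain Ω)
    (hA : IsEllipticCoeff Ω a c₀) {f yd : L2 Ω} {α β p γ : ℝ} (hβ : 0 < β) (hp : 1 < p)
    (hγ : 0 < γ) {y : H10 Ω} {u : L2 Ω} (hsol : IsSolution a c₀ f yd α β p γ y u)
    {z : H10 Ω} {v : L2 Ω} (hz : IsWeakSol a c₀ z v) :
    0 ≤ inner ℝ (toL2 y - yd) (toL2 z) + α * inner ℝ u v + penaltyDir β p γ u v := by
  have := isFiniteMeasure_restrict hΩ
  obtain ⟨B, hB⟩ := exists_continuous_bilin hΩ hA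
  have hu := integrable_of_L2 u
  have hv := integrable_of_L2 v
  set L := inner ℝ (toL2 y - yd) (toL2 z) + α * inner ℝ u v with hL
  set K := 1 / 2 * ‖toL2 z‖ ^ 2 + α / 2 * ‖v‖ ^ 2 with hK
  have hfeas : ∀ t : ℝ, IsWeakSol a c₀ (y + t • z) (u + t • v + f) := by
    intro t w
    have h1 := hsol.feasible w
    have h2 := hz w
    rw [← (hB _ _).1] at h1 h2 ⊢
    rw [map_add, map_smul, add_apply, smul_apply, h1, h2,
      add_right_comm, inner_add_left (u + f), real_inner_smul_left]
    rfl
  -- Minimality at `(y + t z, u + t v)`, with the penalty replaced by its tangent majorant, divided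
  -- by `t`; `t * K` is the second-order part of the quadratic terms.
  have hquot : ∀ t : ℝ, 0 < t → 0 ≤ L + t * K +
      β * ∫ x in Ω, slope p γ (u x) * ((|u x + t * v x| - |u x|) / t) := by
    intro t ht
    have h1 := hsol.minimal _ _ (hfeas t)
    have e1 : toL2 (y + t • z) - yd = (toL2 y - yd) + t • toL2 z := by
      change toL2 y + t • toL2 z - yd = _
      abel
    have h2 := integral_huber_rpow_le hp hγ hu (integrable_of_L2 (u + t • v))
    have e2 : ∫ x in Ω, slope p γ (u x) * (|(u + t • v : L2 Ω) x| - |u x|) =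
        t * ∫ x in Ω, slope p γ (u x) * ((|u x + t * v x| - |u x|) / t) := by
      rw [← integral_const_mul]
      refine integral_congr_ae ?_
      filter_upwards [Lp.coeFn_add u (t • v), Lp.coeFn_smul t v] with x k1 k2
      rw [k1, Pi.add_apply, k2, Pi.smul_apply, smul_eq_mul]
      field_simp
    rw [e2] at h2
    unfold cost penalty at h1
    rw [e1, norm_add_sq_real, norm_add_sq_real, norm_smul, norm_smul, real_inner_smul_right,
      real_inner_smul_right, mul_pow, mul_pow, Real.norm_eq_abs, sq_abs] at h1
    have h3 := mul_le_mul_of_nonneg_left h2 hβ.le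
    refine (mul_nonneg_iff_of_pos_left ht).1 ?_
    rw [hL, hK]
    nlinarith
  have hlim : Tendsto (fun t : ℝ => L + t * K +
      β * ∫ x in Ω, slope p γ (u x) * ((|u x + t * v x| - |u x|) / t)) (𝓝[>] 0)
      (𝓝 (L + 0 * K + β * ∫ x in Ω, slope p γ (u x) * dirAbs (u x) (v x))) := by
    refine Tendsto.add (tendsto_const_nhds.add (Tendsto.mul_const _ ?_))
      ((tendsto_integral_slope_mul hp hγ hu hv).const_mul β)
    exact tendsto_id.mono_left nhdsWithin_le_nhds
  have h := ge_of_tendsto hlim (by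
    filter_upwards [self_mem_nhdsWithin] with t ht using hquot t ht)
  rw [zero_mul, add_zero, ← integral_const_mul] at h
  unfold penaltyDir
  simpa only [mul_assoc] using h

/-- A very weak solution `φ ∈ L²(Ω)` of the adjoint equation, tested with the elements of the
operator domain, belongs to `H₀¹(Ω)` and is a weak solution. -/
lemma exists_adjoint_of_very_weak (hΩ : IsBoundedLipschitzDomain Ω)
    (hA : IsEllipticCoeff Ω a c₀) {s : ℝ} {R : L2 Ω →L[ℝ] H10 Ω}
    (hR : ∀ g v, bilin a c₀ (R g) v + s * inner ℝ (toL2 (R g)) (toL2 v) = inner ℝ g (toL2 v))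
    {φ g : L2 Ω} (h : ∀ v, inner ℝ φ (v - s • toL2 (R v)) = inner ℝ g (toL2 (R v))) :
    ∃ ψ : H10 Ω, toL2 ψ = φ ∧ IsWeakAdjointSol a c₀ ψ g := by
  refine ⟨R (g + s • φ), ?_⟩
  -- The resolvent is symmetric on `L²`, so `(R (g + s φ), v) = (g + s φ, R v)`, which equals `(φ,
  -- v)` by hypothesis.
  have e : toL2 (R (g + s • φ)) = φ := by
    refine ext_inner_right ℝ fun v => ?_
    have h1 := hR (g + s • φ) (R v)
    have h2 := hR v (R (g + s • φ))
    have h3 := h v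
    rw [bilin_comm hΩ hA, real_inner_comm, h2] at h1
    rw [inner_sub_right, real_inner_smul_right] at h3
    rw [real_inner_comm, h1, inner_add_left, real_inner_smul_left]
    linarith
  refine ⟨e, fun v => ?_⟩
  have h1 := hR (g + s • φ) v
  rw [e, inner_add_left, real_inner_smul_left] at h1
  rw [bilin_comm hΩ hA]
  linarith

end SparseControl

/-! ### The optimality system -/

theorem theoremt {n : ℕ} (hn : n = 2 ∨ n = 3)
    (Ω : Set (SparseControl.E n)) (hΩ : SparseControl.IsBoundedLipschitzDomain Ω)
    (a : SparseControl.E n → Matrix (Fin n) (Fin n) ℝ) (c₀ : SparseControl.E n → ℝ)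
    (hA : SparseControl.IsEllipticCoeff Ω a c₀)
    (f yd : SparseControl.L2 Ω) (α β p γ : ℝ)
    (hα : 0 < α) (hβ : 0 < β) (hp : 1 < p) (hγ : 0 < γ)
    (ybar : SparseControl.H10 Ω) (ubar : SparseControl.L2 Ω)
    (hsol : SparseControl.IsSolution a c₀ f yd α β p γ ybar ubar) :
    ∃ (φ : SparseControl.H10 Ω) (ζ w : SparseControl.L2 Ω),
      -- `w` is the explicit function of `ubar`
      (∀ᵐ x ∂(MeasureTheory.volume.restrict Ω), w x = SparseControl.wFun p γ (ubar x)) ∧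
      -- state equation
      SparseControl.IsWeakSol a c₀ ybar (ubar + f) ∧
      -- adjoint equation
      SparseControl.IsWeakAdjointSol a c₀ φ (SparseControl.toL2 ybar - yd) ∧
      -- gradient equation, in `L²(Ω)`
      SparseControl.toL2 φ + α • ubar + β • (SparseControl.delta p γ • ζ - w) = 0 ∧
      -- sign conditions
      (∀ᵐ x ∂(MeasureTheory.volume.restrict Ω),
        (0 < ubar x → ζ x = 1) ∧ (ubar x < 0 → ζ x = -1) ∧ (ubar x = 0 → |ζ x| ≤ 1)) := by
  open SparseControl in
  have := isFiniteMeasure_restrict hΩ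
  have hδ := delta_pos hp hγ
  obtain ⟨s, R, hR⟩ := exists_resolvent hΩ hA
  -- `T v` is the right-hand side for which `R v` solves the state equation, i.e. `A R v`.
  let T : L2 Ω →ₗ[ℝ] L2 Ω :=
    LinearMap.id - s • ((toL2CLM Ω).comp R).toLinearMap
  have hT : ∀ v, T v = v - s • toL2 (R v) := fun _ => rfl
  let l : L2 Ω →ₗ[ℝ] ℝ :=
    -((innerSL ℝ (toL2 ybar - yd)).comp ((toL2CLM Ω).comp R)).toLinearMap -
      α • (innerSL ℝ ubar).toLinearMap.comp T
  have hl : ∀ v, l v = -inner ℝ (toL2 ybar - yd) (toL2 (R v)) - α * inner ℝ ubar (T v) :=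
    fun _ => rfl
  obtain ⟨C, hC⟩ := exists_penaltyDir_le hβ hp hγ ubar
  obtain ⟨q, hqN, hqT⟩ := exists_riesz_of_le_sublinear T l (penaltyDir β p γ ubar) C
    (fun c hc v => penaltyDir_smul ubar v hc) (penaltyDir_add_le hβ hp hγ ubar) hC (by
      intro v
      have hz : IsWeakSol a c₀ (R v) (T v) := by
        intro w
        rw [hT, inner_sub_left, real_inner_smul_left, ← hR]
        ring
      have h := hsol.variational_inequality hΩ hA hβ hp hγ hz
      rw [hl]
      linarith)
  have hsub := ae_subgradient (g := fun x => β * slope p γ (ubar x)) ubar q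
    (fun v hv => integrable_penaltyDir hp hγ ubar hv) hqN
  obtain ⟨φ, hφ, hadj⟩ := exists_adjoint_of_very_weak hΩ hA hR
    -- The gradient equation solved for the adjoint state, with `q` standing for `β (δ_γ ζ - w)`.
    (φ := -(α • ubar) - q) (g := toL2 ybar - yd) (by
      intro v
      have h := hqT v
      rw [hl] at h
      rw [← hT, inner_sub_left, inner_neg_left, real_inner_smul_left, h]
      ring)
  have hw : MemLp (fun x => wFun p γ (ubar x)) 2 (volume.restrict Ω) :=
    .of_bound (measurable_wFun.comp_aemeasurable (integrable_of_L2 ubar).1.aemeasurable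
      ).aestronglyMeasurable (delta p γ) (.of_forall fun x => abs_wFun_le hp hγ _)
  -- `ζ` is determined by `q = β (δ_γ ζ - w)`. Where `ū ≠ 0`, the slope terms of `q / β` and `w`
  -- cancel, leaving `δ_γ sign ū`; where `ū = 0`, `w` vanishes and `|q| ≤ β δ_γ`.
  refine ⟨φ, (delta p γ)⁻¹ • (β⁻¹ • q + hw.toLp _), hw.toLp _, hw.coeFn_toLp, hsol.feasible, hadj,
    ?_, ?_⟩
  · rw [hφ, smul_inv_smul₀ hδ.ne', add_sub_cancel_right, smul_inv_smul₀ hβ.ne']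
    abel
  · filter_upwards [hsub, hw.coeFn_toLp, Lp.coeFn_add (β⁻¹ • q) (hw.toLp _), Lp.coeFn_smul β⁻¹ q,
      Lp.coeFn_smul (delta p γ)⁻¹ (β⁻¹ • q + hw.toLp _)] with x h1 h2 h3 h4 h5
    rw [h5, Pi.smul_apply, h3, Pi.add_apply, h4, Pi.smul_apply, h2, wFun_eq, smul_eq_mul,
      smul_eq_mul]
    refine ⟨fun hx => ?_, fun hx => ?_, fun hx => ?_⟩
    · rw [h1.1 hx.ne', sign_pos hx]
      simp
      field_simp
      ring
    · rw [h1.1 hx.ne, sign_neg hx]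
      simp
      field_simp
      ring
    · have h6 := h1.2 hx
      rw [hx, slope_zero hγ] at *
      rw [sub_self, zero_mul, add_zero, abs_mul, abs_mul, abs_of_pos (inv_pos.2 hδ),
        abs_of_pos (inv_pos.2 hβ), ← mul_assoc, ← mul_inv_rev, inv_mul_le_one₀ (by positivity)]
      exact h6
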